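/- Let $P$ be a simple polygon in the Euclidean plane with $n\ge 3$ edges, listed counterclockwise, and let $\delta$ assign to every edge $e$ of $P$ a real number $\delta(e)\ge 0$. Write $\overline{e}$ for the supporting line and $n_e$ for the inward unit normal of $e$. A *wavefront propagation* of $(P,\delta)$ is a process of the following kind. At time $0$ the wavefront is $P$. At every time $t$ the wavefront consists of finitely many polygons whose edges (fragments) are each emanated by an edge $e$ of $P$, have the direction of $e$, and lie on $\overline{e}+\max(0,t-\delta(e))\,n_e$; that is, each fragment stands still until time $\delta(e)$ and then moves inwards at unit speed in a self-parallel manner. There are finitely many times $0=t_0<t_1<\dots<t_N$ (event and speed-change times). Between two consecutive times the incidences do not change, the vertices move at constant velocity, and the wavefront is planar: its polygons are simple, have disjoint interiors, and share no pieces of edges, though different polygons may touch in points. A vertex between two fragments of equal direction moves along their common normal. At each time $t_i$ with $i\ge 1$, the wavefront is updated so that it is planar again (edge events, split events, speed changes, and any simultaneous combination of these). Fragments of length zero are removed. If two parallel fragments have moved into each other, the portion common to them is removed. The rest of every fragment stays, and is cut only at points that are reached by wavefront vertices. The ends of the remaining fragments are joined anew to closed polygons, where two pieces of one fragment are not joined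 to each other. The process ends at time $t_N$, when all wavefront polygons have collapsed. The *additively-weighted straight skeleton* $\mathcal S(P,\delta)$ of such a propagation is the union of the traces of all wavefront vertices over the whole propagation period $[0,t_N]$ and of all portions common to two parallel fragments that move into each other. **Lemma.** For every simple polygon $P$, all additive weights $\delta\ge 0$, and every wavefront propagation of $(P,\delta)$, the additively-weighted straight skeleton $\mathcal S(P,\delta)$ is connected; indeed, it is a non-empty path-connected subset of the plane. -/

import Mathlib

open scoped NNReal

noncomputable section

namespace StraightSkeleton

/-- The Euclidean plane. -/
abbrev Plane : Type := EuclideanSpace ℝ (Fin 2)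

/-- Counterclockwise rotation by a right angle. -/
def rot90 (v : Plane) : Plane := !₂[-(v 1), v 0]

/-- The two-dimensional cross product. -/
def cross (u v : Plane) : ℝ := u 0 * v 1 - u 1 * v 0

/-- A finite family of closed polygonal curves is given by a finite set `ι` of vertices, a permutation
`next` of `ι` whose cycles are the curves, and the position of every vertex; its edges are the
segments from `pos v` to `pos (next v)`.  This is the curve that passes through vertex `v`. -/
def curve {ι : Type} (next : Equiv.Perm ι) (pos : ι → Plane) (v : ι) : Set Plane :=
  ⋃ w ∈ {w | next.SameCycle v w}, segment ℝ (pos w) (pos (next w))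

/-- The region enclosed by the curve through `v`: the points off the curve whose connected component in
the complement of the curve is bounded. -/
def enclosed {ι : Type} (next : Equiv.Perm ι) (pos : ι → Plane) (v : ι) : Set Plane :=
  {x | x ∉ curve next pos v ∧
    Bornology.IsBounded (connectedComponentIn (curve next pos v)ᶜ x)}

/-- The family is planar if every curve is a simple polygon, and different polygons neither have
common interior points nor share pieces of edges.  (Different polygons may touch in a
point, as they do at the instant of a split event.) -/
structure Planar {ι : Type} (next : Equiv.Perm ι) (pos : ι → Plane) : Prop where
  /-- The vertices of one polygon are distinct points. -/
  injective : ∀ v w, next.SameCycle v w → pos v = pos w → v = w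
  /-- In one polygon, an open edge meets no other edge. -/
  simple : ∀ v w, next.SameCycle v w → v ≠ w →
    Disjoint (openSegment ℝ (pos v) (pos (next v))) (segment ℝ (pos w) (pos (next w)))
  /-- Open edges of different polygons do not meet. -/
  edges : ∀ v w, ¬ next.SameCycle v w →
    Disjoint (openSegment ℝ (pos v) (pos (next v))) (openSegment ℝ (pos w) (pos (next w)))
  /-- Different polygons have disjoint interiors. -/
  interiors : ∀ v w, ¬ next.SameCycle v w →
    Disjoint (enclosed next pos v) (enclosed next pos w)

/-- Simple polygons with at least three vertices, listed in counterclockwise order (positive signed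
area), so that the interior lies to the left of every edge.  Edge `e` runs from vertex `e` to the
cyclically next vertex `finRotate n e`. -/
structure IsSimpleCCW {n : ℕ} (P : Polygon Plane n) : Prop where
  three_le : 3 ≤ n
  simple : Planar (finRotate n) P.vertices
  ccw : 0 < ∑ i, cross (P i) (P (finRotate n i))

/-- The unit direction vector of edge `e` of `P`. -/
def edgeDir {n : ℕ} (P : Polygon Plane n) (e : Fin n) : Plane :=
  ‖P (finRotate n e) - P e‖⁻¹ • (P (finRotate n e) - P e)

/-- The inward unit normal of edge `e` of a counterclockwise polygon `P`. -/
def inwardNormal {n : ℕ} (P : Polygon Plane n) (e : Fin n) : Plane := rot90 (edgeDir P e)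

/-- The supporting line of edge `e`, translated by `max 0 (t - δ e)` in the direction of the inward
normal: the edge stands still until time `δ e` and then moves inwards at unit speed. -/
def offsetLine {n : ℕ} (P : Polygon Plane n) (δ : Fin n → ℝ≥0) (e : Fin n) (t : ℝ) : Set Plane :=
  (fun x => x + max 0 (t - (δ e : ℝ)) • inwardNormal P e) '' line[ℝ, P e, P (finRotate n e)]

/-- The kinetic wavefront during one period without a combinatorial change.  Its wavefront vertices
are `Fin size`, the cycles of `next` are the wavefront polygons, and the wavefront fragment from `v` to
`next v` is emanated by the polygon edge `label v`.  Every vertex moves at constant velocity from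
`start v` to `finish v`.  `size = 0` is the empty wavefront. -/
structure Stage (n : ℕ) where
  size : ℕ
  next : Equiv.Perm (Fin size)
  label : Fin size → Fin n
  start : Fin size → Plane
  finish : Fin size → Plane

namespace Stage

variable {n : ℕ}

/-- The position at time `t` of vertex `v` of a stage that lasts from time `a` to time `b`. -/
def pos (S : Stage n) (a b t : ℝ) (v : Fin S.size) : Plane :=
  AffineMap.lineMap (S.start v) (S.finish v) ((t - a) / (b - a))

/-- The trace of vertex `v` of a stage that lasts from time `a` to time `b`. -/
def trace (S : Stage n) (a b : ℝ) (v : Fin S.size) : Set Plane :=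
  (fun t => S.pos a b t v) '' Set.Icc a b

/-- The initial position of the wavefront fragment from `v` to `next v`. -/
def startFragment (S : Stage n) (v : Fin S.size) : Set Plane :=
  segment ℝ (S.start v) (S.start (S.next v))

/-- The limit position, at the end of the stage, of the wavefront fragment from `v` to `next v`. -/
def finishFragment (S : Stage n) (v : Fin S.size) : Set Plane :=
  segment ℝ (S.finish v) (S.finish (S.next v))

/-- The portion common to the fragments at `v` and `w` at the end of the stage, if these fragments are
parallel and face each other (so that they have moved into each other). -/
def commonPortion (P : Polygon Plane n) (S : Stage n) (v w : Fin S.size) : Set Plane :=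
  {x | edgeDir P (S.label v) = -edgeDir P (S.label w) ∧
    x ∈ S.finishFragment v ∧ x ∈ S.finishFragment w}

/-- The stage `S` starts with exactly the polygon `P`. -/
def StartsWith (P : Polygon Plane n) (S : Stage n) : Prop :=
  ∃ φ : Fin n ≃ Fin S.size, ∀ i,
    S.next (φ i) = φ (finRotate n i) ∧ S.label (φ i) = i ∧ S.start (φ i) = P i

/-- The motion of the wavefront between the times `a` and `b`. -/
structure IsMotion (P : Polygon Plane n) (δ : Fin n → ℝ≥0) (S : Stage n) (a b : ℝ) : Prop where
  /-- Every fragment lies on the moving line of the polygon edge that emanated it. -/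
  mem_line : ∀ v, ∀ t ∈ Set.Icc a b,
    segment ℝ (S.pos a b t v) (S.pos a b t (S.next v)) ⊆ offsetLine P δ (S.label v) t
  /-- Fragments have positive length and keep the direction of their polygon edge (hence the
  interior of the wavefront stays on their left), until the end of the stage. -/
  direction : ∀ v, ∀ t ∈ Set.Ico a b, ∃ c : ℝ, 0 < c ∧
    S.pos a b t (S.next v) - S.pos a b t v = c • edgeDir P (S.label v)
  /-- The wavefront is planar until the end of the stage. -/
  planar : ∀ t ∈ Set.Ico a b, Planar S.next (S.pos a b t)
  /-- A vertex between two fragments of equal direction, for which the two moving lines do not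
  determine the position, moves along the angular bisector, that is, along the common normal. -/
  tangential : ∀ v, edgeDir P (S.label v) = edgeDir P (S.label (S.next v)) →
    ∃ s : ℝ, S.finish (S.next v) - S.start (S.next v) = s • inwardNormal P (S.label v)

/-- The update of the wavefront at the end of the stage `S`; `T` is the stage that follows.  This
covers edge events, split events, speed-change events, parallel fragments that move into
each other, the collapse of wavefront polygons, and any simultaneous occurrence of these.
Fragments of length zero and common portions of parallel fragments that moved into each other are
removed; the rest of every fragment stays, cut into pieces by the vertices that reached it;
and the ends of the remaining fragments are joined anew to form the polygons of `T`. -/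
def Event (P : Polygon Plane n) (S T : Stage n) : Prop :=
  ∃ origin : Fin T.size → Fin S.size,
    -- every new fragment is a piece of an old one, emanated by the same polygon edge
    (∀ w, T.label w = S.label (origin w) ∧
      T.startFragment w ⊆ S.finishFragment (origin w)) ∧
    -- vertices of the new wavefront are only at loci of vertices of the old one
    (∀ w, ∃ u, T.start w = S.finish u) ∧
    -- consecutive new fragments are not pieces of the same old fragment
    (∀ w, origin (T.next w) ≠ origin w) ∧
    -- common portions are removed from the wavefront
    (∀ w v, v ≠ origin w →
      Disjoint (openSegment ℝ (T.start w) (T.start (T.next w)))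
        (commonPortion P S (origin w) v)) ∧
    -- nothing else is removed from a fragment of positive length
    (∀ v, S.finish v ≠ S.finish (S.next v) →
      S.finishFragment v ⊆
        (⋃ w ∈ {w | origin w = v}, T.startFragment w) ∪
        ⋃ u ∈ {u | u ≠ v}, commonPortion P S v u)

end Stage

/-- A wavefront propagation process of the polygon `P` with additive weights `δ`: it starts at
time `0` with `P`, and ends after finitely many stages, when all wavefront polygons have collapsed.
Stage `k` lasts from `time k` to `time (k + 1)`. -/
structure Propagation {n : ℕ} (P : Polygon Plane n) (δ : Fin n → ℝ≥0) where
  numStages : ℕ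
  time : ℕ → ℝ
  stage : ℕ → Stage n
  time_zero : time 0 = 0
  time_lt : ∀ k < numStages, time k < time (k + 1)
  initial : (stage 0).StartsWith P
  motion : ∀ k < numStages, (stage k).IsMotion P δ (time k) (time (k + 1))
  event : ∀ k < numStages, (stage k).Event P (stage (k + 1))
  collapsed : (stage numStages).size = 0

/-- The additively-weighted straight skeleton, as a subset of the plane: the union of the traces of
all wavefront vertices over the whole propagation period, and of the portions common to two
parallel wavefront fragments that move into each other. -/
def Propagation.skeleton {n : ℕ} {P : Polygon Plane n} {δ : Fin n → ℝ≥0}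
    (W : Propagation P δ) : Set Plane :=
  (⋃ k ∈ Set.Iio W.numStages, ⋃ v : Fin (W.stage k).size,
    (W.stage k).trace (W.time k) (W.time (k + 1)) v) ∪
  ⋃ k ∈ Set.Iio W.numStages, ⋃ v : Fin (W.stage k).size, ⋃ u ∈ {u | u ≠ v},
    (W.stage k).commonPortion P v u

end StraightSkeleton

end

/-!
Two neighbouring vertices of the wavefront are joined inside the skeleton, at the beginning of every
stage. This goes by downward induction on the stage, the last one being empty. Both vertices follow
their traces to the end of the stage. The fragment between them is then covered by fragments of the
next stage, whose ends are joined by induction, and by common portions, which belong to the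
skeleton. These finitely many closed pieces meet only in ends of fragments and in common portions,
so the connectedness of the fragment provides a chain of pieces from one end of it to the other.

The initial wavefront is a single polygon, so all its vertices are joined. Following traces
backwards in time joins every later vertex to an initial one, and a non-empty common portion
contains a vertex, since an intersection of two segments of one line contains an end of one of them.
-/

namespace StraightSkeleton

open Set

section ClosedCover

variable {X I : Type*} [TopologicalSpace X] [Finite I] {K : Set X} {C : I → Set X}

theorem reflTransGen_of_isPreconnected_of_finite_closed_cover (hK : IsPreconnected K)
    (hC : ∀ i, IsClosed (C i)) (hcover : K ⊆ ⋃ i, C i) {i j : I} (hi : (K ∩ C i).Nonempty)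
    (hj : (K ∩ C j).Nonempty) :
    Relation.ReflTransGen (fun i j => (K ∩ (C i ∩ C j)).Nonempty) i j := by
  set linked := Relation.ReflTransGen (fun i j => (K ∩ (C i ∩ C j)).Nonempty) i
  by_contra hij
  have hclosed (J : Set I) : IsClosed (⋃ l ∈ J, C l) :=
    J.toFinite.isClosed_biUnion fun l _ => hC l
  obtain ⟨x, hxK, hxlinked, hxrest⟩ := isPreconnected_closed_iff.1 hK
    (⋃ l ∈ {l | linked l}, C l) (⋃ l ∈ {l | linked l}ᶜ, C l) (hclosed _) (hclosed _)
    (by rwa [← biUnion_union, union_compl_self, biUnion_univ])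
    (hi.mono (inter_subset_inter_right K (subset_biUnion_of_mem (u := C) .refl)))
    (hj.mono (inter_subset_inter_right K (subset_biUnion_of_mem (u := C) hij)))
  obtain ⟨l, hl, hxl⟩ := mem_iUnion₂.1 hxlinked
  obtain ⟨m, hm, hxm⟩ := mem_iUnion₂.1 hxrest
  exact hm (hl.tail ⟨x, hxK, hxl, hxm⟩)

/-- `R i` is the part of the piece `C i` that is known to be path-connected inside `F`; the pieces
may leave `F` elsewhere. -/
theorem joinedIn_of_isPreconnected_of_finite_closed_cover {F : Set X} {R : I → Set X}
    (hK : IsPreconnected K) (hC : ∀ i, IsClosed (C i)) (hcover : K ⊆ ⋃ i, C i)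
    (hR : ∀ i, ∀ x ∈ R i, ∀ y ∈ R i, JoinedIn F x y)
    (hCR : Pairwise fun i j => C i ∩ C j ⊆ R i) {x y : X} (hx : x ∈ K) (hy : y ∈ K)
    (hxR : ∀ i, x ∈ C i → x ∈ R i) (hyR : ∀ i, y ∈ C i → y ∈ R i) : JoinedIn F x y := by
  obtain ⟨i, hi⟩ := mem_iUnion.1 (hcover hx)
  obtain ⟨j, hj⟩ := mem_iUnion.1 (hcover hy)
  have hchain := reflTransGen_of_isPreconnected_of_finite_closed_cover hK hC hcover
    ⟨x, hx, hi⟩ ⟨y, hy, hj⟩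
  suffices hjoined : ∀ z ∈ R j, JoinedIn F x z from hjoined y (hyR j hj)
  clear hj
  induction hchain with
  | refl => exact hR i x (hxR i hi)
  | @tail k l _ hkl ih =>
    obtain ⟨z, -, hzk, hzl⟩ := hkl
    obtain rfl | hne := eq_or_ne k l
    · exact ih
    · exact fun y hy => (ih z (hCR hne ⟨hzk, hzl⟩)).trans (hR l z (hCR hne.symm ⟨hzl, hzk⟩) y hy)

end ClosedCover

section Segments

variable {E : Type*} [AddCommGroup E] [Module ℝ E] {a b a' b' : E}

theorem collinear_segment (a b : E) : Collinear ℝ (segment ℝ a b) := by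
  refine (collinear_iff_exists_forall_eq_smul_vadd _).2 ⟨a, b - a, fun x hx => ?_⟩
  rw [segment_eq_image'] at hx
  obtain ⟨r, -, rfl⟩ := hx
  exact ⟨r, add_comm _ _⟩

theorem exists_injective_affineMap_of_collinear {s : Set E} (hs : Collinear ℝ s)
    (hs' : s.Nontrivial) : ∃ L : ℝ →ᵃ[ℝ] E, Function.Injective L ∧ s ⊆ range L := by
  obtain ⟨p, hp, q, hq, hpq⟩ := hs'
  exact ⟨AffineMap.lineMap p q, AffineMap.lineMap_injective ℝ hpq, fun x hx =>
    mem_affineSpan_pair_iff_exists_lineMap_eq.1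
      (hs.mem_affineSpan_of_mem_of_ne hp hq hx hpq)⟩

theorem exists_endpoint_mem_uIcc_inter {α : Type*} [LinearOrder α] {a b a' b' : α}
    (h : (uIcc a b ∩ uIcc a' b').Nonempty) :
    ∃ y ∈ ({a, b, a', b'} : Set α), y ∈ uIcc a b ∩ uIcc a' b' := by
  obtain ⟨x, ⟨h₁, h₂⟩, h₁', h₂'⟩ := h
  refine ⟨(a ⊓ b) ⊔ (a' ⊓ b'), ?_, ⟨le_sup_left, sup_le (h₁.trans h₂) (h₁'.trans h₂)⟩,
    le_sup_right, sup_le (h₁.trans h₂') (h₁'.trans h₂')⟩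
  grind

theorem exists_endpoint_mem_segment_inter (hcol : Collinear ℝ {a, b, a', b'})
    (h : (segment ℝ a b ∩ segment ℝ a' b').Nonempty) :
    ∃ y ∈ ({a, b, a', b'} : Set E), y ∈ segment ℝ a b ∩ segment ℝ a' b' := by
  rcases Set.subsingleton_or_nontrivial ({a, b, a', b'} : Set E) with hsub | hnt
  · refine ⟨a, by simp, left_mem_segment ℝ a b, ?_⟩
    rw [hsub (show a ∈ _ by simp) (show a' ∈ _ by simp)]
    exact left_mem_segment ℝ a' b'
  obtain ⟨L, hL, hrange⟩ := exists_injective_affineMap_of_collinear hcol hnt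
  simp only [insert_subset_iff, singleton_subset_iff] at hrange
  obtain ⟨⟨α, rfl⟩, ⟨β, rfl⟩, ⟨α', rfl⟩, ⟨β', rfl⟩⟩ := hrange
  simp only [← image_segment, ← image_inter hL, segment_eq_uIcc, image_nonempty] at h ⊢
  obtain ⟨y, hy, hmem⟩ := exists_endpoint_mem_uIcc_inter h
  exact ⟨L y, by simpa [hL.eq_iff] using hy, mem_image_of_mem L hmem⟩

theorem segment_inter_segment_subset_of_disjoint_openSegment
    (hcol : Collinear ℝ {a, b, a', b'})
    (hdisj : Disjoint (openSegment ℝ a b) (openSegment ℝ a' b')) :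
    segment ℝ a b ∩ segment ℝ a' b' ⊆ {a, b} := by
  rintro x ⟨hx, hx'⟩
  by_cases hab : a = b
  · subst hab; simpa using hx
  obtain ⟨L, hL, hrange⟩ := exists_injective_affineMap_of_collinear hcol
    ⟨a, by simp, b, by simp, hab⟩
  simp only [insert_subset_iff, singleton_subset_iff] at hrange
  obtain ⟨⟨α, rfl⟩, ⟨β, rfl⟩, ⟨α', rfl⟩, ⟨β', rfl⟩⟩ := hrange
  simp only [← image_segment, ← image_openSegment, disjoint_image_iff hL] at hx hx' hdisj
  obtain ⟨ξ, hξ, rfl⟩ := hx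
  rw [hL.mem_set_image, ← closure_openSegment] at hx'
  have hopen : IsOpen (openSegment ℝ α β) := by
    rw [openSegment_eq_Ioo' (fun h => hab (congrArg L h))]
    exact isOpen_Ioo
  have hξ_notMem : ξ ∉ openSegment ℝ α β := fun hξ' =>
    disjoint_left.1 (hdisj.closure_right hopen) hξ' hx'
  rw [← insert_endpoints_openSegment] at hξ
  simpa [hξ_notMem, hL.eq_iff] using hξ

theorem eq_or_eq_of_mem_segment_of_segment_subset {c d : E} (h : segment ℝ c d ⊆ segment ℝ a b)
    (ha : a ∈ segment ℝ c d) : a = c ∨ a = d := by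
  by_cases hab : a = b
  · subst hab
    have hc : c = a := by simpa using h (left_mem_segment ℝ c d)
    exact .inl hc.symm
  set L := AffineMap.lineMap (k := ℝ) a b
  have hL : Function.Injective L := AffineMap.lineMap_injective ℝ hab
  have hseg : segment ℝ a b = L '' Icc 0 1 := segment_eq_image_lineMap ℝ a b
  obtain ⟨γ, hγ, rfl⟩ := hseg ▸ h (left_mem_segment ℝ c d)
  obtain ⟨η, hη, rfl⟩ := hseg ▸ h (right_mem_segment ℝ (L γ) d)
  rw [← image_segment] at ha
  obtain ⟨ξ, hξ, hξa⟩ := ha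
  obtain rfl : ξ = 0 := hL (by simpa [L] using hξa)
  have hext : (0 : ℝ) ∈ (Icc (0 : ℝ) 1).extremePoints ℝ := by simp
  rcases (mem_extremePoints_iff_forall_segment.1 hext).2 γ hγ η hη
    hξ with rfl | rfl <;> simp [L]

variable [TopologicalSpace E] [IsTopologicalAddGroup E] [ContinuousSMul ℝ E] [T2Space E]

theorem isClosed_segment (a b : E) : IsClosed (segment ℝ a b) :=
  closure_openSegment (𝕜 := ℝ) a b ▸ isClosed_closure

theorem joinedIn_endpoints_of_segment_subset_iUnion {ι κ : Type*} [Finite ι] [Finite κ]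
    {F : Set E} {c d : ι → E} {Q : κ → Set E}
    (hcover : segment ℝ a b ⊆ (⋃ i, segment ℝ (c i) (d i)) ∪ ⋃ k, Q k)
    (hsub : ∀ i, segment ℝ (c i) (d i) ⊆ segment ℝ a b)
    (hdisj : Pairwise fun i j =>
      Disjoint (openSegment ℝ (c i) (d i)) (openSegment ℝ (c j) (d j)))
    (hdisjQ : ∀ i k, Disjoint (openSegment ℝ (c i) (d i)) (Q k))
    (hclosedQ : ∀ k, IsClosed (Q k))
    (hcd : ∀ i, JoinedIn F (c i) (d i))
    (hQ : ∀ k, ∀ x ∈ Q k, ∀ y ∈ Q k, JoinedIn F x y) : JoinedIn F a b := by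
  have hcollinear (i j : ι) : Collinear ℝ {c i, d i, c j, d j} := by
    refine (collinear_segment a b).subset ?_
    simp only [insert_subset_iff, singleton_subset_iff]
    exact ⟨hsub i (left_mem_segment ℝ _ _), hsub i (right_mem_segment ℝ _ _),
      hsub j (left_mem_segment ℝ _ _), hsub j (right_mem_segment ℝ _ _)⟩
  refine joinedIn_of_isPreconnected_of_finite_closed_cover
    (C := Sum.elim (fun i => segment ℝ (c i) (d i)) Q) (R := Sum.elim (fun i => {c i, d i}) Q)
    (convex_segment a b).isPreconnected ?closed ?cover ?joined ?overlap
    (left_mem_segment ℝ a b) (right_mem_segment ℝ a b) ?left ?right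
  case closed => exact Sum.forall.2 ⟨fun i => isClosed_segment _ _, hclosedQ⟩
  case cover => simpa only [iUnion_sum, Sum.elim_inl, Sum.elim_inr] using hcover
  case joined =>
    refine Sum.forall.2 ⟨fun i => ?_, hQ⟩
    have hi := hcd i
    rintro x (rfl | rfl) y (rfl | rfl)
    exacts [.refl hi.source_mem, hi, hi.symm, .refl hi.target_mem]
  case overlap =>
    rintro (i | k) j hij x ⟨hx, hxj⟩
    · rcases j with j | k
      · exact segment_inter_segment_subset_of_disjoint_openSegment (hcollinear i j)
          (hdisj fun h => hij (congrArg Sum.inl h)) ⟨hx, hxj⟩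
      · rw [Sum.elim_inl, ← insert_endpoints_openSegment] at hx
        have hx_notMem : x ∉ openSegment ℝ (c i) (d i) := fun h =>
          disjoint_left.1 (hdisjQ i k) h hxj
        simpa [hx_notMem] using hx
    · exact hx
  case left =>
    exact Sum.forall.2 ⟨fun i => eq_or_eq_of_mem_segment_of_segment_subset (hsub i), fun k => id⟩
  case right =>
    exact Sum.forall.2 ⟨fun i => eq_or_eq_of_mem_segment_of_segment_subset
      (segment_symm ℝ a b ▸ hsub i), fun k => id⟩

end Segments

section OffsetLine

variable {n : ℕ} {P : Polygon Plane n} {δ : Fin n → ℝ≥0} {e : Fin n} {t : ℝ} {x y : Plane}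

theorem exists_eq_smul_edgeDir_vadd_of_mem_offsetLine (hx : x ∈ offsetLine P δ e t)
    (hy : y ∈ offsetLine P δ e t) : ∃ r : ℝ, y = r • edgeDir P e +ᵥ x := by
  obtain ⟨p, hp, rfl⟩ := hx
  obtain ⟨q, hq, rfl⟩ := hy
  have hdir : q -ᵥ p ∈ line[ℝ, P e, P (finRotate n e)].direction :=
    AffineSubspace.vsub_mem_direction hq hp
  rw [direction_affineSpan, mem_vectorSpan_pair_rev] at hdir
  obtain ⟨r, hr⟩ := hdir
  have hedge : ‖P (finRotate n e) - P e‖ • edgeDir P e = P (finRotate n e) - P e :=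
    NormedSpace.norm_smul_normalize _
  refine ⟨r * ‖P (finRotate n e) - P e‖, ?_⟩
  rw [vsub_eq_sub, vsub_eq_sub] at hr
  simp only [mul_smul, hedge, hr, vadd_eq_add]
  abel

end OffsetLine

theorem Planar.pairwise_disjoint_openSegment {ι : Type} {next : Equiv.Perm ι} {pos : ι → Plane}
    (h : Planar next pos) : Pairwise fun v w =>
      Disjoint (openSegment ℝ (pos v) (pos (next v))) (openSegment ℝ (pos w) (pos (next w))) := by
  intro v w hvw
  by_cases hcycle : next.SameCycle v w
  · exact (h.simple v w hcycle hvw).mono_right (openSegment_subset_segment ℝ _ _)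
  · exact h.edges v w hcycle

namespace Stage

variable {n : ℕ} {P : Polygon Plane n} {δ : Fin n → ℝ≥0} {S T : Stage n} {a b : ℝ}

theorem pos_left (S : Stage n) (a b : ℝ) : S.pos a b a = S.start := by
  ext1 v
  simp [pos]

theorem pos_right (S : Stage n) (h : a < b) : S.pos a b b = S.finish := by
  ext1 v
  simp [pos, div_self (sub_pos.2 h).ne']

theorem start_mem_trace (S : Stage n) (h : a ≤ b) (v : Fin S.size) : S.start v ∈ S.trace a b v :=
  ⟨a, left_mem_Icc.2 h, congrFun (S.pos_left a b) v⟩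

theorem finish_mem_trace (S : Stage n) (h : a < b) (v : Fin S.size) :
    S.finish v ∈ S.trace a b v :=
  ⟨b, right_mem_Icc.2 h.le, congrFun (S.pos_right h) v⟩

theorem isPathConnected_trace (S : Stage n) (h : a ≤ b) (v : Fin S.size) :
    IsPathConnected (S.trace a b v) := by
  refine ((convex_Icc a b).isPathConnected (nonempty_Icc.2 h)).image ?_
  simp only [pos, AffineMap.lineMap_apply]
  fun_prop

theorem isClosed_commonPortion (v w : Fin S.size) : IsClosed (S.commonPortion P v w) :=
  isClosed_const.inter ((isClosed_segment _ _).inter (isClosed_segment _ _))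

theorem convex_commonPortion (v w : Fin S.size) : Convex ℝ (S.commonPortion P v w) :=
  fun _ hx _ hy _ _ hr hs hrs => ⟨hx.1, convex_segment _ _ hx.2.1 hy.2.1 hr hs hrs,
    convex_segment _ _ hx.2.2 hy.2.2 hr hs hrs⟩

theorem joinedIn_of_mem_commonPortion {v w : Fin S.size} {x y : Plane}
    (hx : x ∈ S.commonPortion P v w) (hy : y ∈ S.commonPortion P v w) :
    JoinedIn (S.commonPortion P v w) x y :=
  ((convex_commonPortion v w).isPathConnected ⟨x, hx⟩).joinedIn x hx y hy

theorem IsMotion.finishFragment_subset_offsetLine (hS : S.IsMotion P δ a b) (h : a < b)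
    (v : Fin S.size) : S.finishFragment v ⊆ offsetLine P δ (S.label v) b := by
  simpa only [S.pos_right h, finishFragment] using hS.mem_line v b (right_mem_Icc.2 h.le)

theorem IsMotion.exists_finish_mem_commonPortion (hS : S.IsMotion P δ a b) (h : a < b)
    {v w : Fin S.size} (hne : (S.commonPortion P v w).Nonempty) :
    ∃ u, S.finish u ∈ S.commonPortion P v w := by
  obtain ⟨x, hopposite, hxv, hxw⟩ := hne
  have hline {u : Fin S.size} (hxu : x ∈ S.finishFragment u) {y : Plane}
      (hy : y ∈ S.finishFragment u) : ∃ r : ℝ, y = r • edgeDir P (S.label u) +ᵥ x :=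
    exists_eq_smul_edgeDir_vadd_of_mem_offsetLine (hS.finishFragment_subset_offsetLine h u hxu)
      (hS.finishFragment_subset_offsetLine h u hy)
  have hline_v {y : Plane} (hy : y ∈ S.finishFragment w) :
      ∃ r : ℝ, y = r • edgeDir P (S.label v) +ᵥ x := by
    obtain ⟨r, rfl⟩ := hline hxw hy
    exact ⟨-r, by rw [hopposite, neg_smul_neg]⟩
  have hcol : Collinear ℝ
      {S.finish v, S.finish (S.next v), S.finish w, S.finish (S.next w)} := by
    refine (collinear_iff_exists_forall_eq_smul_vadd _).2 ⟨x, edgeDir P (S.label v), ?_⟩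
    rintro y (rfl | rfl | rfl | rfl)
    exacts [hline hxv (left_mem_segment ℝ _ _), hline hxv (right_mem_segment ℝ _ _),
      hline_v (left_mem_segment ℝ _ _), hline_v (right_mem_segment ℝ _ _)]
  obtain ⟨y, hy, hyv, hyw⟩ := exists_endpoint_mem_segment_inter hcol ⟨x, hxv, hxw⟩
  rcases hy with rfl | rfl | rfl | rfl <;> exact ⟨_, hopposite, hyv, hyw⟩

theorem Event.joinedIn_finish_next {F : Set Plane} (hE : S.Event P T)
    (hdisj : Pairwise fun w w' => Disjoint (openSegment ℝ (T.start w) (T.start (T.next w)))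
      (openSegment ℝ (T.start w') (T.start (T.next w'))))
    (hfinish : ∀ v, S.finish v ∈ F) (hcommon : ∀ v u, u ≠ v → S.commonPortion P v u ⊆ F)
    (hT : ∀ w, JoinedIn F (T.start w) (T.start (T.next w))) (v : Fin S.size) :
    JoinedIn F (S.finish v) (S.finish (S.next v)) := by
  by_cases hv : S.finish v = S.finish (S.next v)
  · exact hv ▸ .refl (hfinish v)
  obtain ⟨origin, hpiece, -, -, hremoved, hcover⟩ := hE
  refine joinedIn_endpoints_of_segment_subset_iUnion
    (c := fun w : {w // origin w = v} => T.start w) (d := fun w => T.start (T.next w))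
    (Q := fun u : {u // u ≠ v} => S.commonPortion P v u)
    ?_ ?_ (hdisj.comp_of_injective Subtype.val_injective) ?_
    (fun u => isClosed_commonPortion v u) (fun w => hT w)
    fun u x hx y hy => (joinedIn_of_mem_commonPortion hx hy).mono (hcommon v u u.2)
  · have hcover_v := hcover v hv
    rwa [biUnion_eq_iUnion, biUnion_eq_iUnion] at hcover_v
  · rintro ⟨w, rfl⟩
    exact (hpiece w).2
  · rintro ⟨w, rfl⟩ ⟨u, hu⟩
    exact hremoved w u hu

end Stage

namespace Propagation

variable {n : ℕ} {P : Polygon Plane n} {δ : Fin n → ℝ≥0} (W : Propagation P δ) {k : ℕ}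

theorem trace_subset_skeleton (hk : k < W.numStages) (v : Fin (W.stage k).size) :
    (W.stage k).trace (W.time k) (W.time (k + 1)) v ⊆ W.skeleton := fun _ hx =>
  .inl (mem_biUnion (mem_Iio.2 hk) (mem_iUnion.2 ⟨v, hx⟩))

theorem commonPortion_subset_skeleton (hk : k < W.numStages) (v u : Fin (W.stage k).size)
    (hu : u ≠ v) : (W.stage k).commonPortion P v u ⊆ W.skeleton := fun _ hx =>
  .inr (mem_biUnion (mem_Iio.2 hk) (mem_iUnion.2 ⟨v, mem_iUnion₂.2 ⟨u, hu, hx⟩⟩))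

theorem joinedIn_start_of_mem_trace (hk : k < W.numStages) {v : Fin (W.stage k).size} {x : Plane}
    (hx : x ∈ (W.stage k).trace (W.time k) (W.time (k + 1)) v) :
    JoinedIn W.skeleton ((W.stage k).start v) x :=
  have hle := (W.time_lt k hk).le
  (((W.stage k).isPathConnected_trace hle v).joinedIn _ ((W.stage k).start_mem_trace hle v) x
    hx).mono (W.trace_subset_skeleton hk v)

theorem joinedIn_start_finish (hk : k < W.numStages) (v : Fin (W.stage k).size) :
    JoinedIn W.skeleton ((W.stage k).start v) ((W.stage k).finish v) :=
  W.joinedIn_start_of_mem_trace hk ((W.stage k).finish_mem_trace (W.time_lt k hk) v)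

theorem isEmpty_collapsed : IsEmpty (Fin (W.stage W.numStages).size) :=
  W.collapsed ▸ Fin.isEmpty'

theorem pairwise_disjoint_openSegment_start (hk : k ≤ W.numStages) :
    Pairwise fun v w : Fin (W.stage k).size =>
      Disjoint (openSegment ℝ ((W.stage k).start v) ((W.stage k).start ((W.stage k).next v)))
        (openSegment ℝ ((W.stage k).start w) ((W.stage k).start ((W.stage k).next w))) := by
  obtain rfl | hlt := hk.eq_or_lt
  · exact fun v => W.isEmpty_collapsed.elim v
  · have hplanar := (W.motion k hlt).planar _ (left_mem_Ico.2 (W.time_lt k hlt))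
    rw [Stage.pos_left] at hplanar
    exact hplanar.pairwise_disjoint_openSegment

theorem joinedIn_start_next (hk : k ≤ W.numStages) (v : Fin (W.stage k).size) :
    JoinedIn W.skeleton ((W.stage k).start v) ((W.stage k).start ((W.stage k).next v)) := by
  induction hk using Nat.decreasingInduction with
  | self => exact W.isEmpty_collapsed.elim v
  | of_succ k hk ih =>
    have hfinish : JoinedIn W.skeleton ((W.stage k).finish v)
        ((W.stage k).finish ((W.stage k).next v)) :=
      (W.event k hk).joinedIn_finish_next (W.pairwise_disjoint_openSegment_start hk)
        (fun u => (W.joinedIn_start_finish hk u).target_mem) (W.commonPortion_subset_skeleton hk)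
        ih v
    exact ((W.joinedIn_start_finish hk v).trans hfinish).trans (W.joinedIn_start_finish hk _).symm

theorem joinedIn_initial_start (v w : Fin (W.stage 0).size) :
    JoinedIn W.skeleton ((W.stage 0).start v) ((W.stage 0).start w) := by
  obtain ⟨φ, hφ⟩ := W.initial
  have hnext := W.joinedIn_start_next (Nat.zero_le _)
  obtain ⟨i, rfl⟩ := φ.surjective v
  obtain ⟨j, rfl⟩ := φ.surjective w
  obtain ⟨m, rfl⟩ := Nat.exists_eq_add_one.2 i.pos
  have hzero (i : Fin (m + 1)) :
      JoinedIn W.skeleton ((W.stage 0).start (φ 0)) ((W.stage 0).start (φ i)) := by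
    induction i using Fin.induction with
    | zero => exact .refl (hnext _).source_mem
    | succ i ih =>
      have hstep := hnext (φ i.castSucc)
      rw [(hφ _).1, finRotate_apply, Fin.coeSucc_eq_succ] at hstep
      exact ih.trans hstep
  exact (hzero i).symm.trans (hzero j)

theorem exists_joinedIn_initial_start (hk : k < W.numStages) (w : Fin (W.stage k).size) :
    ∃ v, JoinedIn W.skeleton ((W.stage 0).start v) ((W.stage k).start w) := by
  induction k with
  | zero => exact ⟨w, W.joinedIn_initial_start w w⟩
  | succ k ih =>
    have hk' := k.lt_succ_self.trans hk
    obtain ⟨-, -, hlocus, -⟩ := W.event k hk'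
    obtain ⟨u, hu⟩ := hlocus w
    obtain ⟨v, hv⟩ := ih hk' u
    exact ⟨v, hu ▸ hv.trans (W.joinedIn_start_finish hk' u)⟩

theorem exists_joinedIn_initial {x : Plane} (hx : x ∈ W.skeleton) :
    ∃ v, JoinedIn W.skeleton ((W.stage 0).start v) x := by
  rcases hx with hx | hx
  · obtain ⟨k, hk, hx⟩ := mem_iUnion₂.1 hx
    obtain ⟨w, hx⟩ := mem_iUnion.1 hx
    obtain ⟨v, hv⟩ := W.exists_joinedIn_initial_start hk w
    exact ⟨v, hv.trans (W.joinedIn_start_of_mem_trace hk hx)⟩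
  · obtain ⟨k, hk, hx⟩ := mem_iUnion₂.1 hx
    obtain ⟨w, hx⟩ := mem_iUnion.1 hx
    obtain ⟨u, hu, hx⟩ := mem_iUnion₂.1 hx
    obtain ⟨z, hz⟩ := (W.motion k hk).exists_finish_mem_commonPortion (W.time_lt k hk) ⟨x, hx⟩
    obtain ⟨v, hv⟩ := W.exists_joinedIn_initial_start hk z
    exact ⟨v, (hv.trans (W.joinedIn_start_finish hk z)).trans
      ((Stage.joinedIn_of_mem_commonPortion hz hx).mono
        (W.commonPortion_subset_skeleton hk w u hu))⟩

end Propagation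

end StraightSkeleton

theorem mainTheorem3_general {n : ℕ} [NeZero n] (P : Polygon StraightSkeleton.Plane n)
    (δ : Fin n → ℝ≥0) (W : StraightSkeleton.Propagation P δ) : IsPathConnected W.skeleton := by
  obtain ⟨φ, -⟩ := W.initial
  refine ⟨_, (W.joinedIn_initial_start (φ 0) (φ 0)).source_mem, fun {_} hx => ?_⟩
  obtain ⟨v, hv⟩ := W.exists_joinedIn_initial hx
  exact (W.joinedIn_initial_start (φ 0) v).trans hv

theorem mainTheorem3 {n : ℕ} (P : Polygon StraightSkeleton.Plane n)
    (hP : StraightSkeleton.IsSimpleCCW P) (δ : Fin n → ℝ≥0)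
    (W : StraightSkeleton.Propagation P δ) :
    IsPathConnected W.skeleton :=
  have : NeZero n := ⟨(zero_lt_three.trans_le hP.three_le).ne'⟩
  mainTheorem3_general P δ W
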